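/- Let $(Z,d)$ be a locally compact, complete, separable, geodesic metric space with a base point $e\in Z$, and let $p\ge 1$, $\alpha>0$, $\beta>0$. Let $\mathcal M_p(Z)$ be the space of finite signed Borel measures $\mu$ on $Z$ with $\int_Z d(z,e)^p\,\mathrm d|\mu|(z)<\infty$, and $\mathcal M_p^0(Z)=\{\nu\in\mathcal M_p(Z):\nu(Z)=0\}$. For $\mu\in\mathcal M_p(Z)$ put $$\|\mu\|_{\mathrm{KRu}}=|\mu(Z)|+\sup\Big\{\int_Z f\,\mathrm d\mu : f(e)=0,\ f \text{ is } 1\text{-Lipschitz}\Big\},\qquad G_{\alpha,\beta}(\mu)=\alpha\|\mu\|_{\mathrm{KRu}}+\beta\int_Z(1+d(z,e)^p)\,\mathrm d|\mu|(z),$$ and write $\|\nu\|_{\mathrm{KR}}=\|\nu\|_{\mathrm{KRu}}$ for $\nu\in\mathcal M_p^0(Z)$. Let $B_{\alpha,\beta}=\{\mu\in\mathcal M_p(Z):G_{\alpha,\beta}(\mu)\le 1\}$. (i) If $\mu$ is an extremal point of $B_{\alpha,\beta}$, then there are $x,y\in Z$ (possibly equal) and $a>0$ such that $$\mu=a\delta_x-a\delta_y+\mu(Z)\delta_e,$$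 and $G_{\alpha,\beta}(\mu)=1$; explicitly, $$1=\alpha\big(a\,d(x,y)+|\mu(Z)|\big)+\beta\int_Z(1+d(z,e)^p)\,\mathrm d\big|a\delta_x-a\delta_y+\mu(Z)\delta_e\big|(z).$$ (ii) For $(\nu,c)\in\mathcal M_p^0(Z)\times\mathbb R$ put $\mathcal G_{\alpha,\beta}(\nu,c)=\alpha\|\nu\|_{\mathrm{KR}}+\alpha|c|+\beta\int_Z(1+d(z,e)^p)\,\mathrm d|\nu+c\delta_e|(z)$. Every extremal point of $\{(\nu,c)\in\mathcal M_p^0(Z)\times\mathbb R:\mathcal G_{\alpha,\beta}(\nu,c)\le 1\}$ is of the form $(a\delta_x-a\delta_y,\,c)$ with $x,y\in Z$ (possibly equal), $a>0$ and $c\in\mathbb R$. -/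

import Mathlib

open MeasureTheory

namespace KRExt

/-- A metric space is geodesic if any two points `x`, `y` are joined by an isometric copy of the
interval `[0, dist x y]`. -/
def IsGeodesic (Z : Type*) [MetricSpace Z] : Prop :=
  ∀ x y : Z, ∃ γ : ℝ → Z, γ 0 = x ∧ γ (dist x y) = y ∧
    ∀ s ∈ Set.Icc 0 (dist x y), ∀ t ∈ Set.Icc 0 (dist x y), dist (γ s) (γ t) = |s - t|

noncomputable section

variable {Z : Type*} [MetricSpace Z] [MeasurableSpace Z]

/-- The Dirac mass `δ_x` as a signed measure. -/
def dirac (x : Z) : SignedMeasure Z := (Measure.dirac x).toSignedMeasure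

/-- `ℳ_p(Z)`: the finite signed Borel measures `μ` with `∫ d(z, e)^p d|μ|(z) < ∞`. -/
def momentMeasures (e : Z) (p : ℝ) : Set (SignedMeasure Z) :=
  {μ | Integrable (fun z => dist z e ^ p) μ.totalVariation}

/-- `ℳ_p⁰(Z)`: the balanced measures in `ℳ_p(Z)`, i.e. those with `μ(Z) = 0`. -/
def balancedMomentMeasures (e : Z) (p : ℝ) : Set (SignedMeasure Z) :=
  {ν | ν ∈ momentMeasures e p ∧ ν Set.univ = 0}

/-- `sup {∫ f dμ : f(e) = 0, L(f) ≤ 1}`; on balanced measures with finite first moment this is the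
Kantorovich-Rubinstein norm. -/
def krNorm (e : Z) (μ : SignedMeasure Z) : ℝ :=
  sSup {r : ℝ | ∃ f : Z → ℝ, f e = 0 ∧ LipschitzWith 1 f ∧ r = ∫ᵛ z, f z ∂<•μ}

/-- The unbalanced Kantorovich-Rubinstein norm `‖μ‖_KRu`. -/
def kruNorm (e : Z) (μ : SignedMeasure Z) : ℝ :=
  |μ Set.univ| + krNorm e μ

open Classical in
/-- The regularizer `G_{α,β}`, with value `+∞` off `ℳ_p(Z)`. -/
def regG (e : Z) (p α β : ℝ) (μ : SignedMeasure Z) : EReal :=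
  if μ ∈ momentMeasures e p then
    ((α * kruNorm e μ + β * ∫ z, (1 + dist z e ^ p) ∂μ.totalVariation : ℝ) : EReal)
  else ⊤

/-- The unit ball `B_{α,β} = {μ ∈ ℳ_p(Z) : G_{α,β}(μ) ≤ 1}`. -/
def unitBall (e : Z) (p α β : ℝ) : Set (SignedMeasure Z) :=
  {μ | μ ∈ momentMeasures e p ∧ regG e p α β μ ≤ 1}

/-- The auxiliary functional on `ℳ_p⁰(Z) × ℝ`,
`(ν, c) ↦ α ‖ν‖_KR + α |c| + β ∫ (1 + d(z, e)^p) d|ν + c δ_e|`. -/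
def auxG (e : Z) (p α β : ℝ) (q : SignedMeasure Z × ℝ) : ℝ :=
  α * krNorm e q.1 + α * |q.2|
    + β * ∫ z, (1 + dist z e ^ p) ∂(q.1 + q.2 • dirac e).totalVariation

/-- The unit ball of the auxiliary functional in `ℳ_p⁰(Z) × ℝ`. -/
def auxBall (e : Z) (p α β : ℝ) : Set (SignedMeasure Z × ℝ) :=
  {q | q.1 ∈ balancedMomentMeasures e p ∧ auxG e p α β q ≤ 1}

end

end KRExt

/-!
On `ℳ_p(Z)` the norm `‖μ‖_KRu` is the supremum of `∫ f dμ` over the 1-Lipschitz functions `f` with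
`|f e| ≤ 1` (`integral_le_kruNorm`, `kruNorm_le`), and this set of functions is stable under
pointwise maxima. No transport plans are needed: the following duality argument replaces them.

Let `P` and `N` be the Jordan parts of `μ`, and let `A` be a measurable set. For admissible `f`, `g`,
`∫_A f dP + ∫_{Aᶜ} g dP - ∫ max f g dN ≤ ∫ max f g dμ ≤ ‖μ‖_KRu`.
The term `∫ max f g dN = ∫ g dN + ∫ max (f - g) 0 dN` is sublinear in `f - g`, and a Hahn-Banach
argument (`exists_linearMap_le_of_cone`) replaces it by a linear one, that is, it produces a measure
`m ≤ N`, independent of `f` and `g`, with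
`(∫_A f dP - ∫ f dm) + (∫_{Aᶜ} g dP - ∫ g d(N - m)) ≤ ‖μ‖_KRu`
(`exists_le_measure_split`). So `μ = (P|_A - m) + (P|_{Aᶜ} - (N - m))` is a splitting along which
`‖·‖_KRu`, and evidently the weighted total variation, are additive. If `μ` is an extreme point of
the ball, then `P|_A - m` must be a multiple of `μ` (`eq_smul_of_split`), which forces `P A = 0` or
`P Aᶜ = 0` (`posPart_null_or_null_compl`). Hence `P = a δ_x`, and by symmetry `N = b δ_y`. If
`0 < b < a`, then `μ = b (δ_x - δ_y) + (a - b) δ_x` is again an additive splitting and contradicts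
extremality (`negPart_coeff_eq_zero`); likewise for `0 < a < b`. So `μ` is a dipole or a single atom.

The statement about pairs reduces to this one through the linear bijection `(ν, c) ↦ ν + c δ_e`,
which carries the auxiliary functional to `G_{α,β}` because test functions vanish at `e`
(`add_smul_dirac_base_mem_extremePoints`).
-/

open scoped NNReal

namespace KRExt

/-! ### A sandwich theorem for sublinear functionals and cones -/

section Sandwich

variable {V : Type*} [AddCommGroup V] [Module ℝ V]

/-- A sandwich form of the Hahn-Banach theorem: if `P` is sublinear and `0 ≤ P v + r` for all
`(v, r)` in a convex cone `C`, then `P` may be replaced in this inequality by some linear functional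
`T ≤ P`. It is the M. Riesz extension theorem for the functional `(0, r) ↦ r` and the cone generated
by `C` and the pairs `(-v, r)` with `P v ≤ r`. -/
theorem exists_linearMap_le_of_cone (P : V → ℝ) (hadd : ∀ v w, P (v + w) ≤ P v + P w)
    (hsmul : ∀ c : ℝ, 0 ≤ c → ∀ v, P (c • v) = c * P v) (C : PointedCone ℝ (V × ℝ))
    (hC : ∀ q ∈ C, 0 ≤ P q.1 + q.2) :
    ∃ T : V →ₗ[ℝ] ℝ, (∀ v, T v ≤ P v) ∧ ∀ q ∈ C, 0 ≤ T q.1 + q.2 := by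
  -- The epigraph of `v ↦ P (-v)`.
  let E : PointedCone ℝ (V × ℝ) :=
    { carrier := {q | P (-q.1) ≤ q.2}
      zero_mem' := by simpa using (hsmul 0 le_rfl 0).le
      add_mem' := by
        rintro a b ha hb
        simp only [Set.mem_ofPred_eq, Prod.fst_add, Prod.snd_add, neg_add] at *
        linarith [hadd (-a.1) (-b.1)]
      smul_mem' := by
        rintro c a ha
        have := hsmul c c.2 (-a.1)
        simp only [Set.mem_ofPred_eq] at *
        change P (-((c : ℝ) • a.1)) ≤ (c : ℝ) * a.2
        rw [← smul_neg, this]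
        exact mul_le_mul_of_nonneg_left ha c.2 }
  have hE : ∀ q, q ∈ E ↔ P (-q.1) ≤ q.2 := fun q => Iff.rfl
  let f : (V × ℝ) →ₗ.[ℝ] ℝ :=
    ⟨LinearMap.ker (LinearMap.fst ℝ V ℝ), (LinearMap.snd ℝ V ℝ).comp (Submodule.subtype _)⟩
  have hf : ∀ x : f.domain, f x = (x : V × ℝ).2 := fun x => rfl
  obtain ⟨g, hg, hpos⟩ := riesz_extension (C ⊔ E) f
    (by
      rintro ⟨x, hx⟩ hxs
      rw [hf]
      obtain ⟨b, hb, w, hw, hbw⟩ := Submodule.mem_sup.1 hxs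
      have h1 : b.1 + w.1 = 0 := by
        have hx' : x.1 = 0 := hx
        rw [← hx']; exact congrArg Prod.fst hbw
      have h2 : b.2 + w.2 = x.2 := congrArg Prod.snd hbw
      have h3 := hC b hb
      rw [hE, neg_eq_of_add_eq_zero_left h1] at hw
      simp only
      linarith)
    (by
      intro y
      refine ⟨⟨(0, P (-y.1) - y.2), by simp [f]⟩, ?_⟩
      refine (le_sup_right : E ≤ C ⊔ E) ?_
      rw [hE]
      simp)
  have hg2 : ∀ r : ℝ, g (0, r) = r := fun r => hg ⟨(0, r), by simp [f]⟩
  have hgs : ∀ v r, g (v, r) = g (v, 0) + r := by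
    intro v r
    rw [← hg2 r, ← map_add, hg2]; simp
  refine ⟨g.comp (LinearMap.inl ℝ V ℝ), fun v => ?_, fun q hq => ?_⟩
  · have h := hpos (-v, P v) ((le_sup_right : E ≤ C ⊔ E) (by simp [hE]))
    rw [hgs, show ((-v, 0) : V × ℝ) = -(v, 0) by simp, map_neg] at h
    change g (v, 0) ≤ _
    linarith
  · have h := hpos q ((le_sup_left : C ≤ C ⊔ E) hq)
    rwa [← Prod.mk.eta (p := q), hgs] at h

end Sandwich

/-! ### Splitting a measure along a dual norm -/

section Representation

variable {Z : Type*} [MeasurableSpace Z]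

/-- The real functions integrable with respect to `N`, as functions rather than as classes modulo
almost everywhere equality. -/
def integrableSubmodule (N : Measure Z) : Submodule ℝ (Z → ℝ) where
  carrier := {f | Integrable f N}
  zero_mem' := integrable_zero _ _ _
  add_mem' := fun hf hg => Integrable.add hf hg
  smul_mem' := fun c _ hf => Integrable.smul c hf

theorem integral_max_add_le {N : Measure Z} {f g : Z → ℝ} (hf : Integrable f N)
    (hg : Integrable g N) :
    ∫ z, max (f z + g z) 0 ∂N ≤ ∫ z, max (f z) 0 ∂N + ∫ z, max (g z) 0 ∂N := by
  rw [← integral_add hf.pos_part hg.pos_part]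
  refine integral_mono (hf.add hg).pos_part (hf.pos_part.add hg.pos_part) fun z => ?_
  exact max_le (add_le_add (le_max_left _ _) (le_max_left _ _))
    (add_nonneg (le_max_right _ _) (le_max_right _ _))

/-- A linear functional dominated by `φ ↦ ∫ max φ 0 dN` is the integral against a measure
`m ≤ N`. The values on indicators are finitely additive and bounded by `N`, hence countably
additive. -/
theorem exists_measure_of_le_integral_posPart (N : Measure Z) [IsFiniteMeasure N]
    (T : integrableSubmodule N →ₗ[ℝ] ℝ)
    (hT : ∀ φ : integrableSubmodule N, T φ ≤ ∫ z, max (φ.1 z) 0 ∂N) :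
    ∃ m ≤ N, ∀ φ : integrableSubmodule N, T φ = ∫ z, φ.1 z ∂m := by
  classical
  have hInd : ∀ s, MeasurableSet s → (s.indicator fun _ => (1 : ℝ)) ∈ integrableSubmodule N :=
    fun s hs => (integrable_const (1 : ℝ)).indicator hs
  have hInd0 : ∀ (s : Set Z) z, 0 ≤ s.indicator (fun _ => (1 : ℝ)) z :=
    fun s z => Set.indicator_nonneg (fun _ _ => zero_le_one) z
  have habs : ∀ φ : integrableSubmodule N, |T φ| ≤ ∫ z, |φ.1 z| ∂N := by
    intro φ
    have hφ : Integrable φ.1 N := φ.2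
    rw [abs_le']
    constructor
    · refine (hT φ).trans (integral_mono hφ.pos_part hφ.abs fun z => ?_)
      exact max_le (le_abs_self _) (abs_nonneg _)
    · rw [← map_neg]
      refine (hT (-φ)).trans (integral_mono (-φ).2.pos_part hφ.abs fun z => ?_)
      exact max_le (neg_le_abs _) (abs_nonneg _)
  have hnonneg : ∀ s (hs : MeasurableSet s), 0 ≤ T ⟨_, hInd s hs⟩ := by
    intro s hs
    have h := hT (-⟨_, hInd s hs⟩)
    rw [map_neg] at h
    have : ∫ z, max ((-⟨_, hInd s hs⟩ : integrableSubmodule N).1 z) 0 ∂N = 0 := by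
      refine integral_eq_zero_of_ae (Filter.Eventually.of_forall fun z => ?_)
      exact max_eq_right (neg_nonpos.2 (hInd0 s z))
    linarith
  have hle : ∀ s (hs : MeasurableSet s), T ⟨_, hInd s hs⟩ ≤ N.real s := by
    intro s hs
    refine (hT _).trans_eq ?_
    rw [← integral_indicator_one hs]
    congr 1 with z
    exact max_eq_left (hInd0 s z)
  let ρ : SignedMeasure Z := VectorMeasure.of_additive_of_le_measure (μ := N)
    (fun s => if hs : MeasurableSet s then T ⟨_, hInd s hs⟩ else 0)
    (by
      intro s
      by_cases hs : MeasurableSet s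
      · simp only [hs, dite_true]
        rw [Real.enorm_of_nonneg (hnonneg s hs)]
        exact ENNReal.ofReal_le_of_le_toReal (hle s hs)
      · simp [hs])
    (by
      intro s t hs ht hst
      simp only [hs, ht, hs.union ht, dite_true]
      rw [← map_add]
      congr 1
      ext z
      exact congrFun (Set.indicator_union_of_disjoint hst fun _ => (1 : ℝ)) z)
    (by intro s hs; simp [hs])
  have hρ : ∀ s (hs : MeasurableSet s), ρ s = T ⟨_, hInd s hs⟩ := by
    intro s hs
    change (if hs : MeasurableSet s then T ⟨_, hInd s hs⟩ else 0) = _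
    simp [hs]
  have hρ0 : 0 ≤[Set.univ] ρ := by
    rw [VectorMeasure.le_restrict_univ_iff_le]
    refine VectorMeasure.le_iff.2 fun s hs => ?_
    rw [hρ s hs]
    exact hnonneg s hs
  let m := ρ.toMeasureOfZeroLE Set.univ MeasurableSet.univ hρ0
  have hm : ∀ s (hs : MeasurableSet s), m.real s = T ⟨_, hInd s hs⟩ := by
    intro s hs
    rw [← hρ s hs]
    simpa using ρ.toMeasureOfZeroLE_real_apply hρ0 MeasurableSet.univ hs
  have hmN : m ≤ N := by
    refine Measure.le_iff.2 fun s hs => ?_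
    rw [← ENNReal.toReal_le_toReal (measure_ne_top _ _) (measure_ne_top _ _)]
    exact (hm s hs).trans_le (hle s hs)
  refine ⟨m, hmN, fun φ => ?_⟩
  -- Both sides are `L¹(N)`-continuous and agree on indicators. Since `T` acts on functions, it is
  -- first checked to respect almost everywhere equality.
  suffices h : ∀ f : Z → ℝ, Integrable f N → ∀ hf : f ∈ integrableSubmodule N,
      T ⟨f, hf⟩ = ∫ z, f z ∂m from h φ.1 φ.2 φ.2
  have hcongr : ∀ {f g : Z → ℝ} (hf : f ∈ integrableSubmodule N)
      (hg : g ∈ integrableSubmodule N), f =ᵐ[N] g → T ⟨f, hf⟩ = T ⟨g, hg⟩ := by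
    intro f g hf hg hfg
    rw [← sub_eq_zero, ← map_sub, ← abs_nonpos_iff]
    refine (habs _).trans_eq ?_
    refine integral_eq_zero_of_ae ?_
    filter_upwards [hfg] with z hz
    change |f z - g z| = 0
    simp [hz]
  intro f hf
  refine Integrable.induction (μ := N)
    (fun f => ∀ hf : f ∈ integrableSubmodule N, T ⟨f, hf⟩ = ∫ z, f z ∂m) ?_ ?_ ?_ ?_ hf
  · intro c s hs _ hf
    have : (⟨_, hf⟩ : integrableSubmodule N) = c • ⟨_, hInd s hs⟩ := by
      ext z
      by_cases hz : z ∈ s <;> simp [hz]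
    rw [this, map_smul, ← hm s hs, integral_indicator_const _ hs, smul_eq_mul, smul_eq_mul,
      mul_comm]
  · intro f g _ hf hg hPf hPg hfg
    have : (⟨_, hfg⟩ : integrableSubmodule N) = ⟨f, hf⟩ + ⟨g, hg⟩ := rfl
    rw [this, map_add, hPf hf, hPg hg]
    exact (integral_add (hf.mono_measure hmN) (hg.mono_measure hmN)).symm
  · have hL : ∀ u : Z →₁[N] ℝ, (u : Z → ℝ) ∈ integrableSubmodule N :=
      fun u => L1.integrable_coeFn u
    -- The difference of the two sides, as a bounded functional on `L¹(N)`.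
    let T' : (Z →₁[N] ℝ) →ₗ[ℝ] ℝ :=
      { toFun := fun u => T ⟨u, hL u⟩ - ∫ z, u z ∂m
        map_add' := by
          intro u v
          have h1 : T ⟨_, hL (u + v)⟩ = T (⟨u, hL u⟩ + ⟨v, hL v⟩) :=
            hcongr _ _ (Lp.coeFn_add u v)
          have h2 : ∫ z, (u + v : Z →₁[N] ℝ) z ∂m = ∫ z, u z ∂m + ∫ z, v z ∂m := by
            rw [← integral_add ((hL u).mono_measure hmN) ((hL v).mono_measure hmN)]
            exact integral_congr_ae (ae_mono hmN (Lp.coeFn_add u v))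
          rw [h1, h2, map_add]; ring
        map_smul' := by
          intro c u
          have h1 : T ⟨_, hL (c • u)⟩ = T (c • ⟨u, hL u⟩) :=
            hcongr _ _ (Lp.coeFn_smul c u)
          have h2 : ∫ z, (c • u : Z →₁[N] ℝ) z ∂m = c * ∫ z, u z ∂m := by
            rw [← integral_const_mul]
            exact integral_congr_ae (ae_mono hmN (Lp.coeFn_smul c u))
          rw [h1, h2, map_smul, smul_eq_mul, RingHom.id_apply, smul_eq_mul]; ring }
    have hT' : ∀ u, ‖T' u‖ ≤ 2 * ‖u‖ := by
      intro u
      rw [L1.norm_eq_integral_norm]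
      have h1 := habs ⟨u, hL u⟩
      have h2 : |∫ z, u z ∂m| ≤ ∫ z, |u z| ∂N :=
        (abs_integral_le_integral_abs).trans
          (integral_mono_measure hmN (Filter.Eventually.of_forall fun z => abs_nonneg _)
            (hL u).abs)
      calc ‖T' u‖ ≤ |T ⟨u, hL u⟩| + |∫ z, u z ∂m| := abs_sub _ _
        _ ≤ _ := by simp only [Real.norm_eq_abs] at *; linarith
    have hcont : Continuous T' := (T'.mkContinuous 2 hT').continuous
    have : {u : Z →₁[N] ℝ | ∀ hu : (u : Z → ℝ) ∈ integrableSubmodule N,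
        T ⟨u, hu⟩ = ∫ z, u z ∂m} = {u | T' u = 0} := by
      ext u
      exact ⟨fun h => sub_eq_zero.2 (h (hL u)), fun h _ => sub_eq_zero.1 h⟩
    rw [this]
    exact isClosed_eq hcont continuous_const
  · intro f g hfg hf hPf hg
    rw [← hcongr hf hg hfg, hPf hf]
    exact integral_congr_ae (ae_mono hmN hfg)

/-- If `P` is split as `P|_A + P|_{Aᶜ}`, then `N` can be split as `m + (N - m)` in such a way that
the seminorm dual to `K` is additive: `K` is the epigraph `{(f, t) : ‖f‖ ≤ t}` of a seminorm on
functions whose balls are stable under `max`, and `k` bounds the dual seminorm of `P - N`. Testing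
against `max f g` shows that the sublinear functional `φ ↦ ∫ max φ 0 dN` satisfies the required
inequality, and `exists_linearMap_le_of_cone` turns it into a measure. -/
theorem exists_le_measure_split (P N : Measure Z) [IsFiniteMeasure N]
    (K : PointedCone ℝ ((Z → ℝ) × ℝ))
    (hint : ∀ q ∈ K, Integrable q.1 P ∧ Integrable q.1 N)
    (hsup : ∀ f g t, (f, t) ∈ K → (g, t) ∈ K → ((fun z => max (f z) (g z)), t) ∈ K)
    (k : ℝ) (hk : ∀ q ∈ K, ∫ z, q.1 z ∂P - ∫ z, q.1 z ∂N ≤ k * q.2)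
    {A : Set Z} (hA : MeasurableSet A) :
    ∃ m ≤ N, ∀ f g t, (f, t) ∈ K → (g, t) ∈ K →
      (∫ z in A, f z ∂P - ∫ z, f z ∂m) + (∫ z in Aᶜ, g z ∂P - (∫ z, g z ∂N - ∫ z, g z ∂m))
        ≤ k * t := by
  let W := integrableSubmodule N
  let Φ : W → ℝ := fun φ => ∫ z, max (φ.1 z) 0 ∂N
  -- The required inequality reads `a f g - ∫ (f - g) dm ≤ k * t`.
  let a : (Z → ℝ) → (Z → ℝ) → ℝ := fun f g =>
    ∫ z in A, f z ∂P + ∫ z in Aᶜ, g z ∂P - ∫ z, g z ∂N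
  let C : PointedCone ℝ (W × ℝ) :=
    { carrier := {q | ∃ f g t, (f, t) ∈ K ∧ (g, t) ∈ K ∧ q.1.1 = f - g ∧ q.2 = k * t - a f g}
      zero_mem' := ⟨0, 0, 0, K.zero_mem, K.zero_mem, by simp, by simp [a]⟩
      add_mem' := by
        rintro p q ⟨f, g, t, hf, hg, h1, h2⟩ ⟨f', g', t', hf', hg', h1', h2'⟩
        refine ⟨f + f', g + g', t + t', K.add_mem hf hf', K.add_mem hg hg', ?_, ?_⟩
        · simp only [Prod.fst_add, Submodule.coe_add, h1, h1']; abel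
        · simp only [Prod.snd_add, h2, h2', a, Pi.add_apply]
          rw [integral_add (hint _ hf).1.integrableOn (hint _ hf').1.integrableOn,
            integral_add (hint _ hg).1.integrableOn (hint _ hg').1.integrableOn,
            integral_add (hint _ hg).2 (hint _ hg').2]
          ring
      smul_mem' := by
        rintro c q ⟨f, g, t, hf, hg, h1, h2⟩
        refine ⟨(c : ℝ) • f, (c : ℝ) • g, (c : ℝ) * t, K.smul_mem c.2 hf, K.smul_mem c.2 hg, ?_, ?_⟩
        · change (c : ℝ) • q.1.1 = _
          rw [h1, smul_sub]
        · change (c : ℝ) * q.2 = _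
          simp only [h2, a, Pi.smul_apply, smul_eq_mul, integral_const_mul]
          ring }
  obtain ⟨T, hTΦ, hTC⟩ := exists_linearMap_le_of_cone Φ
    (fun v w => integral_max_add_le v.2 w.2)
    (fun c hc v => by
      simp only [Φ]
      rw [← integral_const_mul]
      congr 1 with z
      change max (c * v.1 z) 0 = _
      rw [mul_max_of_nonneg _ _ hc, mul_zero])
    C (by
      rintro q ⟨f, g, t, hf, hg, h1, h2⟩
      obtain ⟨hfP, hfN⟩ := hint _ hf
      obtain ⟨hgP, hgN⟩ := hint _ hg
      obtain ⟨hmP, hmN⟩ := hint _ (hsup f g t hf hg)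
      have h3 := hk _ (hsup f g t hf hg)
      have h4 : Φ q.1 = ∫ z, max (f z) (g z) ∂N - ∫ z, g z ∂N := by
        simp only [Φ, h1]
        rw [← integral_sub hmN hgN]
        congr 1 with z
        rw [Pi.sub_apply, max_sub_sub_right (f z) (g z) (g z) |>.symm, sub_self]
      have h5 : ∫ z in A, f z ∂P + ∫ z in Aᶜ, g z ∂P ≤ ∫ z, max (f z) (g z) ∂P := by
        rw [← integral_add_compl hA hmP]
        exact add_le_add
          (integral_mono hfP.integrableOn hmP.integrableOn fun z => le_max_left _ _)
          (integral_mono hgP.integrableOn hmP.integrableOn fun z => le_max_right _ _)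
      simp only [h2, a, h4]
      simp only at h3
      linarith)
  obtain ⟨m, hmN, hTm⟩ := exists_measure_of_le_integral_posPart N T hTΦ
  refine ⟨m, hmN, fun f g t hf hg => ?_⟩
  have hfN := (hint _ hf).2
  have hgN := (hint _ hg).2
  have h := hTC (⟨f - g, hfN.sub hgN⟩, k * t - a f g) ⟨f, g, t, hf, hg, rfl, rfl⟩
  rw [hTm] at h
  simp only [Pi.sub_apply, a] at h
  rw [integral_sub (hfN.mono_measure hmN) (hgN.mono_measure hmN)] at h
  linarith

end Representation

/-! ### The cone of Lipschitz functions -/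

section LipCone

variable {Z : Type*} [MetricSpace Z] {e : Z} {p : ℝ}

/-- The epigraph of the Lipschitz norm `f ↦ max (Lip f) |f e|`, as a convex cone: the pairs `(f, t)`
such that `f` is `t`-Lipschitz and `|f e| ≤ t`. By `integral_le_kruNorm` and `kruNorm_le`, the norm
`kruNorm e` is the supremum of `∫ f dμ` over the `f` with `(f, 1) ∈ lipCone e`. -/
def lipCone (e : Z) : PointedCone ℝ ((Z → ℝ) × ℝ) where
  carrier := {q | 0 ≤ q.2 ∧ (∀ x y, |q.1 x - q.1 y| ≤ q.2 * dist x y) ∧ |q.1 e| ≤ q.2}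
  zero_mem' := by simp
  add_mem' := by
    rintro q r ⟨h0, h1, h2⟩ ⟨h0', h1', h2'⟩
    refine ⟨add_nonneg h0 h0', fun x y => ?_, (abs_add_le _ _).trans (add_le_add h2 h2')⟩
    have := (abs_add_le (q.1 x - q.1 y) (r.1 x - r.1 y)).trans (add_le_add (h1 x y) (h1' x y))
    rw [← add_mul] at this
    change |q.1 x + r.1 x - (q.1 y + r.1 y)| ≤ (q.2 + r.2) * dist x y
    rwa [add_sub_add_comm]
  smul_mem' := by
    rintro ⟨c, hc⟩ q ⟨h0, h1, h2⟩
    refine ⟨mul_nonneg hc h0, fun x y => ?_, ?_⟩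
    · change |c * q.1 x - c * q.1 y| ≤ c * q.2 * dist x y
      rw [← mul_sub, abs_mul, abs_of_nonneg hc, mul_assoc]
      exact mul_le_mul_of_nonneg_left (h1 x y) hc
    · change |c * q.1 e| ≤ c * q.2
      rw [abs_mul, abs_of_nonneg hc]
      exact mul_le_mul_of_nonneg_left h2 hc

theorem max_mem_lipCone {f g : Z → ℝ} {t : ℝ} (hf : (f, t) ∈ lipCone e)
    (hg : (g, t) ∈ lipCone e) : ((fun z => max (f z) (g z)), t) ∈ lipCone e :=
  ⟨hf.1, fun x y => (abs_max_sub_max_le_max _ _ _ _).trans (max_le (hf.2.1 x y) (hg.2.1 x y)),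
    abs_max_le_max_abs_abs.trans (max_le hf.2.2 hg.2.2)⟩

theorem neg_mem_lipCone {f : Z → ℝ} {t : ℝ} (hf : (f, t) ∈ lipCone e) :
    ((fun z => -f z), t) ∈ lipCone e :=
  ⟨hf.1, fun x y => by
    change |-f x - -f y| ≤ t * dist x y
    rw [neg_sub_neg, abs_sub_comm]; exact hf.2.1 x y, (abs_neg (f e)).trans_le hf.2.2⟩

theorem mem_lipCone_of_lipschitzWith {f : Z → ℝ} (hf : LipschitzWith 1 f) (he : f e = 0) :
    (f, (1 : ℝ)) ∈ lipCone e :=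
  ⟨zero_le_one, fun x y => by simpa [Real.dist_eq] using hf.dist_le_mul x y, by simp [he]⟩

theorem zero_mem_lipCone_one : ((fun _ : Z => (0 : ℝ)), (1 : ℝ)) ∈ lipCone e :=
  ⟨zero_le_one, fun x y => by simp, by simp⟩

theorem weight_nonneg (z : Z) : 0 ≤ 1 + dist z e ^ p :=
  add_nonneg zero_le_one (Real.rpow_nonneg dist_nonneg p)

end LipCone

/-! ### The unbalanced Kantorovich-Rubinstein norm and the regularizer -/

section Functionals

variable {Z : Type*} [MetricSpace Z] [MeasurableSpace Z] [BorelSpace Z] {e : Z} {p α β : ℝ}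

/-- Lipschitz functions are integrable against a finite measure with finite `p`-th moment, `p ≥ 1`,
since `d ≤ 1 + d ^ p`. -/
theorem integrable_of_dist_le {m : Measure Z} [IsFiniteMeasure m] (hp : 1 ≤ p)
    (hm : Integrable (fun z => dist z e ^ p) m) {f : Z → ℝ} {t : ℝ} (ht : 0 ≤ t)
    (hf : ∀ x y, |f x - f y| ≤ t * dist x y) : Integrable f m := by
  have hcont : Continuous f := by
    have : LipschitzWith t.toNNReal f := LipschitzWith.of_dist_le_mul fun x y => by
      rw [Real.coe_toNNReal t ht]; exact hf x y
    exact this.continuous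
  refine Integrable.mono' (((integrable_const (1 : ℝ)).add hm).const_mul t |>.add
    (integrable_const |f e|)) hcont.measurable.aestronglyMeasurable
    (Filter.Eventually.of_forall fun z => ?_)
  have h1 : dist z e ≤ 1 + dist z e ^ p := by
    rcases le_total (dist z e) 1 with h | h
    · have := Real.rpow_nonneg (dist_nonneg (x := z) (y := e)) p
      linarith
    · have := Real.rpow_le_rpow_of_exponent_le h hp
      rw [Real.rpow_one] at this
      linarith
  have h2 := mul_le_mul_of_nonneg_left h1 ht
  have h3 := abs_sub_abs_le_abs_sub (f z) (f e)
  have h4 := hf z e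
  change ‖f z‖ ≤ t * (1 + dist z e ^ p) + |f e|
  rw [Real.norm_eq_abs]
  linarith

omit [BorelSpace Z] in
theorem mem_momentMeasures_of_le {μ : SignedMeasure Z} {m : Measure Z}
    (hm : Integrable (fun z => dist z e ^ p) m) (h : μ.totalVariation ≤ m) :
    μ ∈ momentMeasures e p :=
  hm.mono_measure h

theorem integrable_of_mem_lipCone {m : Measure Z} [IsFiniteMeasure m] (hp : 1 ≤ p)
    (hm : Integrable (fun z => dist z e ^ p) m) {f : Z → ℝ} {t : ℝ} (hf : (f, t) ∈ lipCone e) :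
    Integrable f m :=
  integrable_of_dist_le hp hm hf.1 hf.2.1

theorem vectorIntegrable_of_mem_lipCone {μ : SignedMeasure Z} (hp : 1 ≤ p)
    (hμ : μ ∈ momentMeasures e p) {f : Z → ℝ} {t : ℝ} (hf : (f, t) ∈ lipCone e) :
    μ.Integrable f := by
  rw [VectorMeasure.Integrable, ← SignedMeasure.totalVariation_eq_variation]
  exact integrable_of_mem_lipCone hp hμ hf

omit [MetricSpace Z] [BorelSpace Z] in
theorem isFiniteMeasure_variation (μ : SignedMeasure Z) : IsFiniteMeasure μ.variation := by
  rw [← SignedMeasure.totalVariation_eq_variation]; infer_instance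

theorem bddAbove_krNorm {μ : SignedMeasure Z} (hp : 1 ≤ p) (hμ : μ ∈ momentMeasures e p) :
    BddAbove {r : ℝ | ∃ f : Z → ℝ, f e = 0 ∧ LipschitzWith 1 f ∧ r = ∫ᵛ z, f z ∂<•μ} := by
  have hd : Integrable (fun z => dist z e) μ.totalVariation :=
    integrable_of_dist_le hp hμ zero_le_one fun x y => by
      rw [one_mul]; exact abs_dist_sub_le x y e
  refine ⟨∫ z, dist z e ∂μ.totalVariation, ?_⟩
  rintro r ⟨f, hfe, hf, rfl⟩
  have hfi := integrable_of_mem_lipCone hp hμ (mem_lipCone_of_lipschitzWith hf hfe)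
  have h := VectorMeasure.norm_integral_le_integral_norm (μ := μ)
    (B := (ContinuousLinearMap.lsmul ℝ ℝ (E := ℝ)).flip) (f := f)
  rw [ContinuousLinearMap.opNorm_flip, ← SignedMeasure.totalVariation_eq_variation] at h
  replace h := h.trans (mul_le_of_le_one_left (integral_nonneg fun z => norm_nonneg (f z))
    ContinuousLinearMap.opNorm_lsmul_le)
  refine (le_abs_self _).trans (h.trans (integral_mono hfi.norm hd fun z => ?_))
  have := hf.dist_le_mul z e
  simpa [Real.dist_eq, hfe] using this

theorem integral_le_kruNorm {μ : SignedMeasure Z} (hp : 1 ≤ p) (hμ : μ ∈ momentMeasures e p)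
    {f : Z → ℝ} (hf : (f, (1 : ℝ)) ∈ lipCone e) : ∫ᵛ z, f z ∂<•μ ≤ kruNorm e μ := by
  have := isFiniteMeasure_variation μ
  have hconst : μ.Integrable fun _ : Z => f e := integrable_const _
  have hfi := vectorIntegrable_of_mem_lipCone hp hμ hf
  have h1 : ∫ᵛ z, (f z - f e) ∂<•μ ≤ krNorm e μ := by
    refine le_csSup (bddAbove_krNorm hp hμ) ⟨fun z => f z - f e, sub_self _, ?_, rfl⟩
    refine LipschitzWith.of_dist_le_mul fun x y => ?_
    simpa [Real.dist_eq] using hf.2.1 x y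
  rw [VectorMeasure.integral_fun_sub hfi hconst, VectorMeasure.integral_const] at h1
  have h2 : μ Set.univ * f e ≤ |μ Set.univ| := by
    refine (le_abs_self _).trans ?_
    rw [abs_mul]
    exact mul_le_of_le_one_right (abs_nonneg _) hf.2.2
  change _ - μ Set.univ * f e ≤ _ at h1
  unfold kruNorm
  linarith

/-- The converse of `integral_le_kruNorm`: a competitor for `krNorm`, which vanishes at `e`, is
shifted by the sign of `μ(Z)` to pick up the term `|μ(Z)|`. -/
theorem kruNorm_le {μ : SignedMeasure Z} (hp : 1 ≤ p) (hμ : μ ∈ momentMeasures e p) {k : ℝ}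
    (hk : ∀ f : Z → ℝ, (f, (1 : ℝ)) ∈ lipCone e → ∫ᵛ z, f z ∂<•μ ≤ k) : kruNorm e μ ≤ k := by
  have := isFiniteMeasure_variation μ
  suffices krNorm e μ ≤ k - |μ Set.univ| by unfold kruNorm; linarith
  refine csSup_le ⟨_, fun _ => 0, rfl, LipschitzWith.const' _, rfl⟩ ?_
  rintro r ⟨f, hfe, hf, rfl⟩
  obtain ⟨u, hu, huμ⟩ : ∃ u : ℝ, |u| ≤ 1 ∧ μ Set.univ * u = |μ Set.univ| := by
    rcases le_total 0 (μ Set.univ) with h | h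
    · exact ⟨1, by simp, by rw [mul_one, abs_of_nonneg h]⟩
    · exact ⟨-1, by simp, by rw [mul_neg_one, abs_of_nonpos h]⟩
  have hc := mem_lipCone_of_lipschitzWith hf hfe
  have h := hk (fun z => f z + u) ⟨zero_le_one, fun x y => by
    simpa using hc.2.1 x y, by simpa [hfe] using hu⟩
  rw [VectorMeasure.integral_fun_add (vectorIntegrable_of_mem_lipCone hp hμ hc)
    (integrable_const u), VectorMeasure.integral_const] at h
  change _ + μ Set.univ * u ≤ _ at h
  linarith

theorem kruNorm_nonneg {μ : SignedMeasure Z} (hp : 1 ≤ p) (hμ : μ ∈ momentMeasures e p) :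
    0 ≤ kruNorm e μ := by
  simpa using! integral_le_kruNorm hp hμ zero_mem_lipCone_one

omit [MetricSpace Z] [BorelSpace Z] in
theorem totalVariation_smul (c : ℝ) (μ : SignedMeasure Z) :
    (c • μ).totalVariation = ‖c‖₊ • μ.totalVariation := by
  simp only [SignedMeasure.totalVariation_eq_variation, VectorMeasure.variation_smul]

omit [BorelSpace Z] in
theorem smul_mem_momentMeasures {μ : SignedMeasure Z} (hμ : μ ∈ momentMeasures e p) (c : ℝ) :
    c • μ ∈ momentMeasures e p := by
  refine mem_momentMeasures_of_le (m := ‖c‖₊ • μ.totalVariation) ?_ (totalVariation_smul c μ).le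
  exact Integrable.smul_measure_nnreal hμ

/-- The real number `G_{α,β}(μ)`, meaningful for `μ ∈ ℳ_p(Z)`; see `regG_eq_coe`. -/
noncomputable def regReal (e : Z) (p α β : ℝ) (μ : SignedMeasure Z) : ℝ :=
  α * kruNorm e μ + β * ∫ z, (1 + dist z e ^ p) ∂μ.totalVariation

omit [BorelSpace Z] in
theorem regG_eq_coe {μ : SignedMeasure Z} (hμ : μ ∈ momentMeasures e p) :
    regG e p α β μ = (regReal e p α β μ : ℝ) := if_pos hμ

omit [BorelSpace Z] in
theorem mem_unitBall {μ : SignedMeasure Z} :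
    μ ∈ unitBall e p α β ↔ μ ∈ momentMeasures e p ∧ regReal e p α β μ ≤ 1 := by
  refine and_congr_right fun h => ?_
  rw [regG_eq_coe h]
  exact_mod_cast Iff.rfl

theorem kruNorm_smul_le {μ : SignedMeasure Z} (hp : 1 ≤ p) (hμ : μ ∈ momentMeasures e p) {c : ℝ}
    (hc : 0 ≤ c) : kruNorm e (c • μ) ≤ c * kruNorm e μ := by
  refine kruNorm_le hp (smul_mem_momentMeasures hμ c) fun f hf => ?_
  rw [VectorMeasure.integral_smul_vectorMeasure]
  exact mul_le_mul_of_nonneg_left (integral_le_kruNorm hp hμ hf) hc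

theorem regReal_smul_le {μ : SignedMeasure Z} (hp : 1 ≤ p) (hα : 0 < α)
    (hμ : μ ∈ momentMeasures e p) {c : ℝ} (hc : 0 ≤ c) :
    regReal e p α β (c • μ) ≤ c * regReal e p α β μ := by
  have h1 := mul_le_mul_of_nonneg_left (kruNorm_smul_le hp hμ hc) hα.le
  have h2 : ∫ z, (1 + dist z e ^ p) ∂(c • μ).totalVariation
      = c * ∫ z, (1 + dist z e ^ p) ∂μ.totalVariation := by
    rw [totalVariation_smul, integral_smul_nnreal_measure]
    change ‖c‖ * _ = _
    rw [Real.norm_of_nonneg hc]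
  unfold regReal
  rw [h2]
  linarith

omit [BorelSpace Z] in
theorem integrable_weight {μ : SignedMeasure Z} (hμ : μ ∈ momentMeasures e p) :
    Integrable (fun z => 1 + dist z e ^ p) μ.totalVariation :=
  (integrable_const (1 : ℝ)).add hμ

theorem totalVariation_real_le {μ : SignedMeasure Z} (hp : 1 ≤ p) (hα : 0 < α) (hβ : 0 < β)
    (hμ : μ ∈ momentMeasures e p) :
    β * μ.totalVariation.real Set.univ ≤ regReal e p α β μ := by
  have h1 := mul_nonneg hα.le (kruNorm_nonneg hp hμ)
  have h2 : μ.totalVariation.real Set.univ ≤ ∫ z, (1 + dist z e ^ p) ∂μ.totalVariation := by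
    rw [← integral_indicator_one MeasurableSet.univ]
    refine integral_mono ((integrable_const (1 : ℝ)).indicator MeasurableSet.univ)
      (integrable_weight hμ) fun z => ?_
    have := Real.rpow_nonneg (dist_nonneg (x := z) (y := e)) p
    simpa using this
  have h3 := mul_le_mul_of_nonneg_left h2 hβ.le
  unfold regReal
  linarith

theorem regReal_nonneg {μ : SignedMeasure Z} (hp : 1 ≤ p) (hα : 0 < α) (hβ : 0 < β)
    (hμ : μ ∈ momentMeasures e p) : 0 ≤ regReal e p α β μ :=
  (mul_nonneg hβ.le measureReal_nonneg).trans (totalVariation_real_le hp hα hβ hμ)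

theorem eq_zero_of_regReal_nonpos {μ : SignedMeasure Z} (hp : 1 ≤ p) (hα : 0 < α) (hβ : 0 < β)
    (hμ : μ ∈ momentMeasures e p) (h : regReal e p α β μ ≤ 0) : μ = 0 := by
  have h1 := (totalVariation_real_le hp hα hβ hμ).trans h
  have h2 : μ.totalVariation.real Set.univ = 0 :=
    le_antisymm (nonpos_of_mul_nonpos_right h1 hβ) measureReal_nonneg
  have h3 := (measureReal_eq_zero_iff).1 h2
  rw [SignedMeasure.totalVariation_eq_variation, Measure.measure_univ_eq_zero] at h3
  exact VectorMeasure.variation_eq_zero.1 h3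

omit [MetricSpace Z] [BorelSpace Z] in
theorem totalVariation_le_of_add_le {μ μ₁ μ₂ : SignedMeasure Z}
    (h : μ₁.totalVariation + μ₂.totalVariation ≤ μ.totalVariation) :
    μ₁.totalVariation ≤ μ.totalVariation ∧ μ₂.totalVariation ≤ μ.totalVariation :=
  ⟨(Measure.le_add_right le_rfl).trans h, (Measure.le_add_left le_rfl).trans h⟩

theorem regReal_add_le_of_split {μ μ₁ μ₂ : SignedMeasure Z} (hp : 1 ≤ p) (hα : 0 < α)
    (hβ : 0 < β) (hμ : μ ∈ momentMeasures e p)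
    (hTV : μ₁.totalVariation + μ₂.totalVariation ≤ μ.totalVariation)
    (hpair : ∀ f g : Z → ℝ, (f, (1 : ℝ)) ∈ lipCone e → (g, (1 : ℝ)) ∈ lipCone e →
      ∫ᵛ z, f z ∂<•μ₁ + ∫ᵛ z, g z ∂<•μ₂ ≤ kruNorm e μ) :
    regReal e p α β μ₁ + regReal e p α β μ₂ ≤ regReal e p α β μ := by
  obtain ⟨h1, h2⟩ := totalVariation_le_of_add_le hTV
  have hμ₁ : μ₁ ∈ momentMeasures e p := mem_momentMeasures_of_le hμ h1
  have hμ₂ : μ₂ ∈ momentMeasures e p := mem_momentMeasures_of_le hμ h2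
  have hkru : kruNorm e μ₁ + kruNorm e μ₂ ≤ kruNorm e μ := by
    rw [← le_sub_iff_add_le]
    refine kruNorm_le hp hμ₁ fun f hf => ?_
    rw [le_sub_comm]
    refine kruNorm_le hp hμ₂ fun g hg => ?_
    linarith [hpair f g hf hg]
  have hw : ∫ z, (1 + dist z e ^ p) ∂μ₁.totalVariation
      + ∫ z, (1 + dist z e ^ p) ∂μ₂.totalVariation
      ≤ ∫ z, (1 + dist z e ^ p) ∂μ.totalVariation := by
    rw [← integral_add_measure (integrable_weight hμ₁) (integrable_weight hμ₂)]
    exact integral_mono_measure hTV (Filter.Eventually.of_forall weight_nonneg)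
      (integrable_weight hμ)
  have h3 := mul_le_mul_of_nonneg_left hkru hα.le
  have h4 := mul_le_mul_of_nonneg_left hw hβ.le
  unfold regReal
  linarith

/-- If an extreme point `μ` of the unit ball is a sum `μ₁ + μ₂` along which both the total variation
and the dual pairing with the Lipschitz ball are additive, then `μ₁` is a multiple of `μ`. -/
theorem eq_smul_of_split {μ μ₁ μ₂ : SignedMeasure Z} (hp : 1 ≤ p) (hα : 0 < α)
    (hβ : 0 < β) (hμ : μ ∈ Set.extremePoints ℝ (unitBall e p α β)) (hadd : μ₁ + μ₂ = μ)
    (hTV : μ₁.totalVariation + μ₂.totalVariation ≤ μ.totalVariation)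
    (hpair : ∀ f g : Z → ℝ, (f, (1 : ℝ)) ∈ lipCone e → (g, (1 : ℝ)) ∈ lipCone e →
      ∫ᵛ z, f z ∂<•μ₁ + ∫ᵛ z, g z ∂<•μ₂ ≤ kruNorm e μ) :
    ∃ t : ℝ, μ₁ = t • μ := by
  obtain ⟨hμm, hμ1⟩ := mem_unitBall.1 hμ.1
  have hsum := (regReal_add_le_of_split hp hα hβ hμm hTV hpair).trans hμ1
  obtain ⟨h1, h2⟩ := totalVariation_le_of_add_le hTV
  have hμ₁ : μ₁ ∈ momentMeasures e p := mem_momentMeasures_of_le hμm h1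
  have hμ₂ : μ₂ ∈ momentMeasures e p := mem_momentMeasures_of_le hμm h2
  set c := regReal e p α β μ₁ with hc
  rcases le_or_gt c 0 with hc0 | hc0
  · exact ⟨0, by rw [zero_smul, eq_zero_of_regReal_nonpos hp hα hβ hμ₁ hc0]⟩
  rcases le_or_gt (regReal e p α β μ₂) 0 with hd0 | hd0
  · exact ⟨1, by rw [one_smul, ← hadd, eq_zero_of_regReal_nonpos hp hα hβ hμ₂ hd0, add_zero]⟩
  have hc1 : 0 < 1 - c := by linarith
  have hb : ∀ {ν : SignedMeasure Z} {s : ℝ}, ν ∈ momentMeasures e p → 0 < s →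
      regReal e p α β ν ≤ s → s⁻¹ • ν ∈ unitBall e p α β := by
    intro ν s hν hs hle
    refine mem_unitBall.2 ⟨smul_mem_momentMeasures hν _, ?_⟩
    refine (regReal_smul_le hp hα hν (inv_nonneg.2 hs.le)).trans ?_
    rw [inv_mul_le_iff₀ hs, mul_one]
    exact hle
  -- The weights are `c = G(μ₁)` and `1 - c ≥ G(μ₂)`, so that both normalized parts are in the ball.
  have h := hμ.2 (hb hμ₁ hc0 le_rfl) (hb hμ₂ hc1 (by linarith))
    ⟨c, 1 - c, hc0, hc1, by ring, by
      rw [smul_inv_smul₀ hc0.ne', smul_inv_smul₀ hc1.ne', hadd]⟩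
  exact ⟨c, by rw [← h, smul_inv_smul₀ hc0.ne']⟩

end Functionals

/-! ### Differences of finite measures and zero-one measures -/

section Differences

variable {Z : Type*} [MeasurableSpace Z]

theorem totalVariation_toSignedMeasure_sub_le (m n : Measure Z) [IsFiniteMeasure m]
    [IsFiniteMeasure n] : (m.toSignedMeasure - n.toSignedMeasure).totalVariation ≤ m + n := by
  rw [SignedMeasure.totalVariation_eq_variation]
  simpa using VectorMeasure.variation_sub_le (μ := m.toSignedMeasure) (ν := n.toSignedMeasure)

theorem integral_toSignedMeasure_sub {m n : Measure Z} [IsFiniteMeasure m] [IsFiniteMeasure n]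
    {f : Z → ℝ} (hm : Integrable f m) (hn : Integrable f n) :
    ∫ᵛ z, f z ∂<•(m.toSignedMeasure - n.toSignedMeasure) = ∫ z, f z ∂m - ∫ z, f z ∂n := by
  rw [VectorMeasure.integral_sub_vectorMeasure, VectorMeasure.integral_toSignedMeasure,
    VectorMeasure.integral_toSignedMeasure]
  · simpa [VectorMeasure.Integrable] using hm
  · simpa [VectorMeasure.Integrable] using hn

/-- A finite measure for which every measurable set is null or conull is a multiple of a Dirac
mass. -/
theorem exists_eq_smul_dirac_of_null_or_null_compl [StandardBorelSpace Z] [Nonempty Z]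
    (P : Measure Z) [IsFiniteMeasure P]
    (hP : ∀ A, MeasurableSet A → P A = 0 ∨ P Aᶜ = 0) :
    ∃ (a : ℝ≥0) (x : Z), P = a • Measure.dirac x := by
  rcases eq_or_ne P 0 with h0 | h0
  · exact ⟨0, Classical.arbitrary Z, by simp [h0]⟩
  have hu : P Set.univ ≠ 0 := by rwa [Ne, Measure.measure_univ_eq_zero]
  have hu' : P Set.univ ≠ ⊤ := measure_ne_top _ _
  have : IsZeroOneMeasure ((P Set.univ)⁻¹ • P) := ⟨fun A hA => by
    rcases hP A hA with h | h
    · left; simp [h]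
    · right
      rw [Measure.smul_apply, ← ENNReal.inv_mul_cancel hu hu',
        ← measure_add_measure_compl (μ := P) hA, h, add_zero, smul_eq_mul]⟩
  have : NeZero ((P Set.univ)⁻¹ • P) := ⟨fun h => by
    have := congrArg (fun m : Measure Z => m Set.univ) h
    simp [hu, hu'] at this⟩
  obtain ⟨x, hx⟩ := IsZeroOneMeasure.exists_eq_dirac (μ := (P Set.univ)⁻¹ • P)
  refine ⟨(P Set.univ).toNNReal, x, ?_⟩
  rw [← hx]
  change P = ((P Set.univ).toNNReal : ENNReal) • _
  rw [ENNReal.coe_toNNReal hu', smul_smul, ENNReal.mul_inv_cancel hu hu', one_smul]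

end Differences

/-! ### Jordan parts of extreme points -/

section Extreme

variable {Z : Type*} [MetricSpace Z] [MeasurableSpace Z] [BorelSpace Z] {e : Z} {p α β : ℝ}

theorem integral_le_kruNorm_mul {μ : SignedMeasure Z} (hp : 1 ≤ p)
    (hμ : μ ∈ momentMeasures e p) {f : Z → ℝ} {t : ℝ} (hf : (f, t) ∈ lipCone e) :
    ∫ᵛ z, f z ∂<•μ ≤ kruNorm e μ * t := by
  rcases hf.1.eq_or_lt with ht | ht
  · have ht' : t = 0 := ht.symm
    have h0 : f = fun _ => 0 := by
      ext z
      have h1 := hf.2.1 z e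
      have h2 := hf.2.2
      simp only [ht', zero_mul] at h1 h2
      have h3 := abs_nonpos_iff.1 h1
      have h4 := abs_nonpos_iff.1 h2
      linarith
    rw [h0, ht', mul_zero, VectorMeasure.integral_zero]
  · have h := integral_le_kruNorm hp hμ (f := t⁻¹ • f) (by
      have := (lipCone e).smul_mem (inv_nonneg.2 ht.le) hf
      have h1 : t⁻¹ * t = 1 := inv_mul_cancel₀ ht.ne'
      change (t⁻¹ • f, t⁻¹ * t) ∈ lipCone e at this
      rwa [h1] at this)
    rw [VectorMeasure.integral_smul, smul_eq_mul, inv_mul_le_iff₀ ht] at h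
    rwa [mul_comm]

omit [MetricSpace Z] [BorelSpace Z] in
theorem jordan_sub (μ : SignedMeasure Z) :
    μ.toJordanDecomposition.posPart.toSignedMeasure
      - μ.toJordanDecomposition.negPart.toSignedMeasure = μ :=
  μ.toSignedMeasure_toJordanDecomposition

/-- The positive part of an extreme point cannot be cut into two nontrivial pieces: for a set `A`
with `0 < μ⁺(A) < μ⁺(Z)`, the negative part could be distributed over the two pieces by
`exists_le_measure_split`, giving a nontrivial additive splitting of `μ`. -/
theorem posPart_null_or_null_compl {μ : SignedMeasure Z} (hp : 1 ≤ p) (hα : 0 < α)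
    (hβ : 0 < β) (hμ : μ ∈ Set.extremePoints ℝ (unitBall e p α β)) {A : Set Z}
    (hA : MeasurableSet A) :
    μ.toJordanDecomposition.posPart A = 0 ∨ μ.toJordanDecomposition.posPart Aᶜ = 0 := by
  have hμm := (mem_unitBall.1 hμ.1).1
  set P := μ.toJordanDecomposition.posPart with hP
  set N := μ.toJordanDecomposition.negPart with hN
  have hPN : P.toSignedMeasure - N.toSignedMeasure = μ := jordan_sub μ
  have hTV : μ.totalVariation = P + N := rfl
  have hPle : P ≤ μ.totalVariation := hTV ▸ Measure.le_add_right le_rfl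
  have hNle : N ≤ μ.totalVariation := hTV ▸ Measure.le_add_left le_rfl
  have hint : ∀ q ∈ lipCone e, Integrable q.1 P ∧ Integrable q.1 N := fun q hq =>
    ⟨(integrable_of_mem_lipCone hp hμm hq).mono_measure hPle,
      (integrable_of_mem_lipCone hp hμm hq).mono_measure hNle⟩
  obtain ⟨m, hmN, hm⟩ := exists_le_measure_split P N (lipCone e) hint
    (fun f g t hf hg => max_mem_lipCone hf hg) (kruNorm e μ)
    (fun q hq => by
      rw [← integral_toSignedMeasure_sub (hint q hq).1 (hint q hq).2, hPN]
      exact integral_le_kruNorm_mul hp hμm hq) hA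
  have : IsFiniteMeasure m := isFiniteMeasure_of_le N hmN
  obtain ⟨n, hn⟩ : ∃ n, n = N - m := ⟨_, rfl⟩
  have hnm : n + m = N := hn ▸ Measure.sub_add_cancel_of_le hmN
  have : IsFiniteMeasure n := isFiniteMeasure_of_le N (hnm ▸ Measure.le_add_right le_rfl)
  have hnN : n ≤ N := hnm ▸ Measure.le_add_right le_rfl
  have hPA : P.restrict A + P.restrict Aᶜ = P := Measure.restrict_add_restrict_compl hA
  obtain ⟨t, ht⟩ := eq_smul_of_split
    (μ₁ := (P.restrict A).toSignedMeasure - m.toSignedMeasure)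
    (μ₂ := (P.restrict Aᶜ).toSignedMeasure - n.toSignedMeasure) hp hα hβ hμ
    (by
      have h1 : P.toSignedMeasure
          = (P.restrict A).toSignedMeasure + (P.restrict Aᶜ).toSignedMeasure := by
        rw [← Measure.toSignedMeasure_add]; exact Measure.toSignedMeasure_congr hPA.symm
      have h2 : N.toSignedMeasure = n.toSignedMeasure + m.toSignedMeasure := by
        rw [← Measure.toSignedMeasure_add]; exact Measure.toSignedMeasure_congr hnm.symm
      refine Eq.trans ?_ hPN
      rw [h1, h2]
      abel)
    (by
      refine (add_le_add (totalVariation_toSignedMeasure_sub_le _ _)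
        (totalVariation_toSignedMeasure_sub_le _ _)).trans_eq ?_
      rw [hTV, add_add_add_comm, hPA, add_comm m n, hnm])
    (by
      intro f g hf hg
      have hgn : ∫ z, g z ∂n = ∫ z, g z ∂N - ∫ z, g z ∂m := by
        rw [← hnm, integral_add_measure ((hint _ hg).2.mono_measure hnN)
          ((hint _ hg).2.mono_measure hmN), add_sub_cancel_right]
      rw [integral_toSignedMeasure_sub (hint _ hf).1.integrableOn
          ((hint _ hf).2.mono_measure hmN),
        integral_toSignedMeasure_sub (hint _ hg).1.integrableOn
          ((hint _ hg).2.mono_measure hnN), hgn]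
      simpa using hm f g 1 hf hg)
  -- Compare `μ₁ = t • μ` on subsets of a set carrying `P` and null for `N`.
  obtain ⟨S, hS, hPS, hNS⟩ := μ.toJordanDecomposition.mutuallySingular
  rw [← hP] at hPS
  rw [← hN] at hNS
  have key : ∀ B, MeasurableSet B →
      P.real (B ∩ A) = t * P.real B := by
    intro B hB
    have hB' : MeasurableSet (B ∩ Sᶜ) := hB.inter hS.compl
    have h := congrArg (fun ν : SignedMeasure Z => ν (B ∩ Sᶜ)) ht
    have hN0 : N (B ∩ Sᶜ) = 0 := measure_mono_null Set.inter_subset_right hNS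
    have hm0 : m (B ∩ Sᶜ) = 0 := le_antisymm ((hmN _).trans hN0.le) bot_le
    have hPS' : ∀ D, P.real (D ∩ Sᶜ) = P.real D := fun D =>
      congrArg ENNReal.toReal (measure_inter_conull (by simpa using hPS))
    simp only [_root_.smul_apply, ← hPN] at h
    rw [Measure.toSignedMeasure_sub_apply hB', Measure.toSignedMeasure_sub_apply hB',
      measureReal_restrict_apply hB', Set.inter_right_comm, hPS', hPS', measureReal_def m, hm0,
      measureReal_def N, hN0] at h
    simpa using h
  have h1 := key A hA
  have h2 := key Aᶜ hA.compl
  rw [Set.inter_self] at h1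
  rw [Set.compl_inter_self, measureReal_empty, eq_comm, mul_eq_zero] at h2
  rcases h2 with h2 | h2
  · left
    rw [h2, zero_mul] at h1
    exact (measureReal_eq_zero_iff).1 h1
  · exact Or.inr ((measureReal_eq_zero_iff).1 h2)

theorem neg_mem_unitBall {μ : SignedMeasure Z} (hp : 1 ≤ p) (hα : 0 < α)
    (hμ : μ ∈ unitBall e p α β) : -μ ∈ unitBall e p α β := by
  obtain ⟨h1, h2⟩ := mem_unitBall.1 hμ
  have hTV := SignedMeasure.totalVariation_neg μ
  have hm : -μ ∈ momentMeasures e p := mem_momentMeasures_of_le h1 hTV.le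
  refine mem_unitBall.2 ⟨hm, le_trans ?_ h2⟩
  have hk : kruNorm e (-μ) ≤ kruNorm e μ := by
    refine kruNorm_le hp hm fun f hf => ?_
    rw [VectorMeasure.integral_neg_vectorMeasure, ← VectorMeasure.integral_fun_neg]
    exact integral_le_kruNorm hp h1 (neg_mem_lipCone hf)
  unfold regReal
  rw [hTV]
  have := mul_le_mul_of_nonneg_left hk hα.le
  linarith

theorem neg_mem_extremePoints {μ : SignedMeasure Z} (hp : 1 ≤ p) (hα : 0 < α)
    (hμ : μ ∈ Set.extremePoints ℝ (unitBall e p α β)) :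
    -μ ∈ Set.extremePoints ℝ (unitBall e p α β) := by
  refine ⟨neg_mem_unitBall hp hα hμ.1, fun ν₁ h₁ ν₂ h₂ h => ?_⟩
  obtain ⟨a, b, ha, hb, hab, h⟩ := h
  rw [← hμ.2 (neg_mem_unitBall hp hα h₁) (neg_mem_unitBall hp hα h₂)
    ⟨a, b, ha, hb, hab, by rw [smul_neg, smul_neg, ← neg_add, h, neg_neg]⟩, neg_neg]

theorem integrable_smul_dirac (a : ℝ≥0) (x : Z) (f : Z → ℝ) :
    Integrable f (a • Measure.dirac x) :=
  (integrable_dirac (by simp)).smul_measure_nnreal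

theorem integral_nnreal_smul_dirac (a : ℝ≥0) (x : Z) (f : Z → ℝ) :
    ∫ z, f z ∂(a • Measure.dirac x) = a * f x := by
  rw [integral_smul_nnreal_measure, integral_dirac]; rfl

/-- An extreme point `a δ_x - b δ_y` with `b < a` has `b = 0`; otherwise
`b (δ_x - δ_y) + (a - b) δ_x` is a nontrivial additive splitting, as the single test function
`1 + d(x, e) - d(x, ·)` attains the norms of both summands. -/
theorem negPart_coeff_eq_zero {μ : SignedMeasure Z} (hp : 1 ≤ p) (hα : 0 < α) (hβ : 0 < β)
    (hμ : μ ∈ Set.extremePoints ℝ (unitBall e p α β)) {a b : ℝ≥0} {x y : Z}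
    (hP : μ.toJordanDecomposition.posPart = a • Measure.dirac x)
    (hN : μ.toJordanDecomposition.negPart = b • Measure.dirac y) (hab : b < a) : b = 0 := by
  by_contra hb
  have hμm := (mem_unitBall.1 hμ.1).1
  have ha : a ≠ 0 := (hab.trans_le' bot_le).ne'
  have hxy : x ≠ y := by
    rintro rfl
    obtain ⟨S, hS, hPS, hNS⟩ := μ.toJordanDecomposition.mutuallySingular
    rw [hP] at hPS
    rw [hN] at hNS
    by_cases hx : x ∈ S
    · exact ha (by simpa [Measure.dirac_apply' _ hS, hx] using hPS)
    · exact hb (by simpa [Measure.dirac_apply' _ hS.compl, hx] using hNS)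
  have hba : b + (a - b) = a := add_tsub_cancel_of_le hab.le
  have hμ' : (a • Measure.dirac x).toSignedMeasure - (b • Measure.dirac y).toSignedMeasure = μ := by
    rw [← jordan_sub μ]
    exact congrArg₂ _ (Measure.toSignedMeasure_congr hP.symm)
      (Measure.toSignedMeasure_congr hN.symm)
  have hsum : b • Measure.dirac x + (a - b) • Measure.dirac x = a • Measure.dirac x := by
    rw [← add_smul, hba]
  have hsum' : (a • Measure.dirac x).toSignedMeasure
      = (b • Measure.dirac x).toSignedMeasure + ((a - b) • Measure.dirac x).toSignedMeasure := by
    rw [← Measure.toSignedMeasure_add]; exact Measure.toSignedMeasure_congr hsum.symm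
  obtain ⟨t, ht⟩ := eq_smul_of_split
    (μ₁ := (b • Measure.dirac x).toSignedMeasure - (b • Measure.dirac y).toSignedMeasure)
    (μ₂ := ((a - b) • Measure.dirac x).toSignedMeasure - (0 : Measure Z).toSignedMeasure)
    hp hα hβ hμ
    (by
      rw [← hμ', hsum', Measure.toSignedMeasure_zero]
      abel)
    (by
      refine (add_le_add (totalVariation_toSignedMeasure_sub_le _ _)
        (totalVariation_toSignedMeasure_sub_le _ _)).trans_eq ?_
      rw [SignedMeasure.totalVariation, hP, hN, add_zero, add_right_comm, hsum])
    (by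
      intro f g hf hg
      have hI : ∀ (c : ℝ≥0) z (f : Z → ℝ), Integrable f (c • Measure.dirac z) :=
        integrable_smul_dirac
      rw [integral_toSignedMeasure_sub (hI _ _ _) (hI _ _ _),
        integral_toSignedMeasure_sub (hI _ _ _) integrable_zero_measure]
      have h := integral_le_kruNorm hp hμm (f := fun z => 1 + dist x e - dist x z)
        ⟨zero_le_one, fun u v => by
          change |(1 + dist x e - dist x u) - (1 + dist x e - dist x v)| ≤ 1 * dist u v
          rw [sub_sub_sub_cancel_left, one_mul, dist_comm u v, dist_comm x v, dist_comm x u]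
          exact abs_dist_sub_le v u x, by simp⟩
      rw [← hμ', integral_toSignedMeasure_sub (hI _ _ _) (hI _ _ _), hμ'] at h
      simp only [integral_nnreal_smul_dirac, integral_zero_measure, dist_self] at h ⊢
      have hc : ((a - b : ℝ≥0) : ℝ) = a - b := NNReal.coe_sub hab.le
      rw [hc]
      have h1 : f x - f y ≤ dist x y := by
        have := (le_abs_self _).trans (hf.2.1 x y)
        rwa [one_mul] at this
      have h2 : g x ≤ 1 + dist x e := by
        have h3 := (le_abs_self _).trans (hg.2.1 x e)
        have h4 := (le_abs_self _).trans hg.2.2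
        simp only [one_mul] at h3 h4
        linarith
      have h3 := mul_le_mul_of_nonneg_left h1 b.coe_nonneg
      have h4 : ((a : ℝ) - b) * g x ≤ (a - b) * (1 + dist x e) :=
        mul_le_mul_of_nonneg_left h2 (sub_nonneg.2 (NNReal.coe_le_coe.2 hab.le))
      nlinarith)
  have hev : ∀ B, MeasurableSet B → ((b • Measure.dirac x).real B - (b • Measure.dirac y).real B
      = t * ((a • Measure.dirac x).real B - (b • Measure.dirac y).real B)) := by
    intro B hB
    have h := congrArg (fun ν : SignedMeasure Z => ν B) ht
    simp only [_root_.smul_apply, ← hμ'] at h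
    rwa [Measure.toSignedMeasure_sub_apply hB, Measure.toSignedMeasure_sub_apply hB] at h
  have h1 := hev Set.univ MeasurableSet.univ
  have h2 := hev {x} (measurableSet_singleton x)
  have hab' : (b : ℝ) < a := NNReal.coe_lt_coe.2 hab
  simp only [measureReal_nnreal_smul_apply, probReal_univ, mul_one, sub_self] at h1
  have ht0 : t = 0 := by
    rcases mul_eq_zero.1 h1.symm with h | h
    · exact h
    · exact absurd h (sub_pos.2 hab').ne'
  rw [ht0, zero_mul] at h2
  have hx1 : (Measure.dirac x).real {x} = 1 := by simp [measureReal_def]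
  have hy0 : (Measure.dirac y).real {x} = 0 := by simp [measureReal_def, hxy.symm]
  simp only [measureReal_nnreal_smul_apply, hx1, hy0, mul_one, mul_zero, sub_zero] at h2
  exact hb (NNReal.coe_eq_zero.1 h2)

end Extreme

/-! ### Dirac masses as signed measures -/

section Dirac

variable {Z : Type*} [MeasurableSpace Z]

theorem totalVariation_dirac (x : Z) : (dirac x).totalVariation = Measure.dirac x := by
  rw [SignedMeasure.totalVariation_eq_variation, dirac, Measure.variation_toSignedMeasure]

theorem dirac_univ (x : Z) : dirac x Set.univ = 1 := by
  simp [dirac]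

theorem dirac_ne_zero (x : Z) : dirac x ≠ 0 := fun h => by
  have := congrArg (fun μ : SignedMeasure Z => μ Set.univ) h
  simp [dirac_univ] at this

theorem toSignedMeasure_nnreal_smul_dirac (a : ℝ≥0) (x : Z) :
    (a • Measure.dirac x).toSignedMeasure = (a : ℝ) • dirac x :=
  Measure.toSignedMeasure_smul _ a

end Dirac

/-! ### Shape of the extreme points and the auxiliary ball -/

section Conclusion

variable {Z : Type*} [MetricSpace Z] [MeasurableSpace Z] [BorelSpace Z] {e : Z} {p α β : ℝ}

theorem dirac_mem_momentMeasures (x : Z) : dirac x ∈ momentMeasures e p := by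
  change Integrable _ _
  rw [totalVariation_dirac]
  exact integrable_dirac (by simp)

omit [BorelSpace Z] in
theorem add_mem_momentMeasures {μ ν : SignedMeasure Z} (hμ : μ ∈ momentMeasures e p)
    (hν : ν ∈ momentMeasures e p) : μ + ν ∈ momentMeasures e p := by
  refine mem_momentMeasures_of_le (m := μ.totalVariation + ν.totalVariation)
    (integrable_add_measure.2 ⟨hμ, hν⟩) ?_
  simp only [SignedMeasure.totalVariation_eq_variation]
  exact VectorMeasure.variation_add_le

omit [BorelSpace Z] in
theorem sub_mem_momentMeasures {μ ν : SignedMeasure Z} (hμ : μ ∈ momentMeasures e p)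
    (hν : ν ∈ momentMeasures e p) : μ - ν ∈ momentMeasures e p := by
  refine mem_momentMeasures_of_le (m := μ.totalVariation + ν.totalVariation)
    (integrable_add_measure.2 ⟨hμ, hν⟩) ?_
  simp only [SignedMeasure.totalVariation_eq_variation]
  exact VectorMeasure.variation_sub_le

theorem ne_zero_of_mem_extremePoints {μ : SignedMeasure Z} (hp : 1 ≤ p) (hα : 0 < α)
    (hβ : 0 < β) (hμ : μ ∈ Set.extremePoints ℝ (unitBall e p α β)) : μ ≠ 0 := by
  rintro rfl
  have hd : dirac e ∈ momentMeasures e p := dirac_mem_momentMeasures e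
  have hJ := regReal_nonneg hp hα hβ hd
  -- A small multiple of `δ_e` and its negative lie in the ball and have midpoint `0`.
  set c : ℝ := (1 + regReal e p α β (dirac e))⁻¹ with hc
  have hc0 : 0 < c := inv_pos.2 (by linarith)
  have h1 : c • dirac e ∈ unitBall e p α β := by
    refine mem_unitBall.2 ⟨smul_mem_momentMeasures hd c, ?_⟩
    refine (regReal_smul_le hp hα hd hc0.le).trans ?_
    rw [hc, inv_mul_le_iff₀ (by linarith)]
    linarith
  have h2 := hμ.2 h1 (neg_mem_unitBall hp hα h1)
    ⟨1 / 2, 1 / 2, by norm_num, by norm_num, by norm_num, by simp⟩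
  exact (smul_ne_zero hc0.ne' (dirac_ne_zero e)) h2

theorem regReal_eq_one_of_mem_extremePoints {μ : SignedMeasure Z} (hp : 1 ≤ p) (hα : 0 < α)
    (hβ : 0 < β) (hμ : μ ∈ Set.extremePoints ℝ (unitBall e p α β)) :
    regReal e p α β μ = 1 := by
  have hμ0 := ne_zero_of_mem_extremePoints hp hα hβ hμ
  obtain ⟨hμm, hμ1⟩ := mem_unitBall.1 hμ.1
  refine le_antisymm hμ1 (not_lt.1 fun hlt => hμ0 ?_)
  set c := regReal e p α β μ with hc
  have hc0 : 0 < c := not_le.1 fun h => hμ0 (eq_zero_of_regReal_nonpos hp hα hβ hμm h)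
  have h0 : (0 : SignedMeasure Z) ∈ unitBall e p α β := by
    have h := regReal_smul_le (β := β) hp hα hμm le_rfl
    rw [zero_smul, zero_mul] at h
    refine mem_unitBall.2 ⟨?_, h.trans zero_le_one⟩
    simpa using smul_mem_momentMeasures hμm 0
  have h1 : c⁻¹ • μ ∈ unitBall e p α β := by
    refine mem_unitBall.2 ⟨smul_mem_momentMeasures hμm _, ?_⟩
    refine (regReal_smul_le hp hα hμm (inv_nonneg.2 hc0.le)).trans_eq ?_
    exact inv_mul_cancel₀ hc0.ne'
  exact (hμ.2 h0 h1 ⟨1 - c, c, by linarith, hc0, by ring, by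
    rw [smul_zero, zero_add, smul_inv_smul₀ hc0.ne']⟩).symm

theorem integral_dirac_vec (x : Z) (f : Z → ℝ) : ∫ᵛ z, f z ∂<•(dirac x) = f x := by
  rw [dirac, VectorMeasure.integral_toSignedMeasure, integral_dirac]

theorem vectorIntegrable_dirac (x : Z) (f : Z → ℝ) : (dirac x).Integrable f := by
  rw [VectorMeasure.Integrable, ← SignedMeasure.totalVariation_eq_variation, totalVariation_dirac]
  exact integrable_dirac (by simp)

/-- Test functions vanish at `e`, so a Dirac mass at `e` does not contribute to `krNorm e`. -/
theorem krNorm_add_smul_dirac_base {ν : SignedMeasure Z} (hp : 1 ≤ p)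
    (hν : ν ∈ momentMeasures e p) (c : ℝ) : krNorm e (ν + c • dirac e) = krNorm e ν := by
  unfold krNorm
  congr 1
  ext r
  refine exists_congr fun f => and_congr_right fun hfe => and_congr_right fun hf => ?_
  rw [VectorMeasure.integral_add_vectorMeasure
    (vectorIntegrable_of_mem_lipCone hp hν (mem_lipCone_of_lipschitzWith hf hfe))
    ((vectorIntegrable_dirac e f).smul_vectorMeasure c),
    VectorMeasure.integral_smul_vectorMeasure, integral_dirac_vec, hfe, smul_zero, add_zero]

theorem krNorm_smul_dirac_sub_smul_dirac (x y : Z) {a : ℝ} (ha : 0 ≤ a) :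
    krNorm e (a • dirac x - a • dirac y) = a * dist x y := by
  have hI : ∀ f : Z → ℝ, ∫ᵛ z, f z ∂<•(a • dirac x - a • dirac y) = a * (f x - f y) := by
    intro f
    rw [VectorMeasure.integral_sub_vectorMeasure
      ((vectorIntegrable_dirac x f).smul_vectorMeasure a)
      ((vectorIntegrable_dirac y f).smul_vectorMeasure a),
      VectorMeasure.integral_smul_vectorMeasure, VectorMeasure.integral_smul_vectorMeasure,
      integral_dirac_vec, integral_dirac_vec, smul_eq_mul, smul_eq_mul, mul_sub]
  refine IsGreatest.csSup_eq ⟨⟨fun z => dist z y - dist e y, sub_self _, ?_, ?_⟩, ?_⟩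
  · refine LipschitzWith.of_dist_le_mul fun u v => ?_
    rw [Real.dist_eq, sub_sub_sub_cancel_right, NNReal.coe_one, one_mul]
    exact abs_dist_sub_le u v y
  · rw [hI, dist_self]; ring
  · rintro r ⟨f, -, hf, rfl⟩
    rw [hI]
    refine mul_le_mul_of_nonneg_left ?_ ha
    have := hf.dist_le_mul x y
    rw [NNReal.coe_one, one_mul, Real.dist_eq] at this
    exact (le_abs_self _).trans this

/-- Extreme points of the unit ball are `a δ_x - b δ_y` with `a = b`, `a = 0` or `b = 0`; in the last
two cases the remaining atom is written as a dipole with `e` plus the total mass at `e`. -/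
theorem exists_eq_of_mem_extremePoints [StandardBorelSpace Z] {μ : SignedMeasure Z} (hp : 1 ≤ p)
    (hα : 0 < α) (hβ : 0 < β) (hμ : μ ∈ Set.extremePoints ℝ (unitBall e p α β)) :
    ∃ (x y : Z) (a : ℝ), 0 < a ∧
      μ = a • dirac x - a • dirac y + μ Set.univ • dirac e := by
  have : Nonempty Z := ⟨e⟩
  have hneg := neg_mem_extremePoints hp hα hμ
  have hjpos : (-μ).toJordanDecomposition.posPart = μ.toJordanDecomposition.negPart := by
    rw [SignedMeasure.toJordanDecomposition_neg, JordanDecomposition.neg_posPart]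
  have hjneg : (-μ).toJordanDecomposition.negPart = μ.toJordanDecomposition.posPart := by
    rw [SignedMeasure.toJordanDecomposition_neg, JordanDecomposition.neg_negPart]
  obtain ⟨a, x, hP⟩ := exists_eq_smul_dirac_of_null_or_null_compl
    μ.toJordanDecomposition.posPart fun A hA => posPart_null_or_null_compl hp hα hβ hμ hA
  obtain ⟨b, y, hN⟩ := exists_eq_smul_dirac_of_null_or_null_compl
    μ.toJordanDecomposition.negPart fun A hA => by
      rw [← hjpos]; exact posPart_null_or_null_compl hp hα hβ hneg hA
  have hμ' : μ = (a : ℝ) • dirac x - (b : ℝ) • dirac y := by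
    rw [← toSignedMeasure_nnreal_smul_dirac, ← toSignedMeasure_nnreal_smul_dirac]
    refine (jordan_sub μ).symm.trans ?_
    exact congrArg₂ _ (Measure.toSignedMeasure_congr hP) (Measure.toSignedMeasure_congr hN)
  have hu : μ Set.univ = a - b := by
    rw [hμ', _root_.sub_apply, _root_.smul_apply, _root_.smul_apply, dirac_univ, dirac_univ]
    simp
  have hμ0 := ne_zero_of_mem_extremePoints hp hα hβ hμ
  rw [hu]
  rcases lt_trichotomy a b with h | h | h
  · have ha : a = 0 := negPart_coeff_eq_zero hp hα hβ hneg (hjpos.trans hN) (hjneg.trans hP) h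
    refine ⟨e, y, b, NNReal.coe_pos.2 (h.trans_le' bot_le), ?_⟩
    rw [hμ', ha, NNReal.coe_zero]
    module
  · refine ⟨x, y, a, NNReal.coe_pos.2 (pos_iff_ne_zero.2 fun ha => hμ0 ?_), ?_⟩
    · rw [hμ', ← h, ha]; simp
    · rw [hμ', ← h]; simp
  · have hb : b = 0 := negPart_coeff_eq_zero hp hα hβ hμ hP hN h
    refine ⟨x, e, a, NNReal.coe_pos.2 (h.trans_le' bot_le), ?_⟩
    rw [hμ', hb, NNReal.coe_zero]
    module

/-- The functionals `G_{α,β}` and `auxG` correspond under `(ν, c) ↦ ν + c δ_e`. -/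
theorem regReal_add_smul_dirac_base {ν : SignedMeasure Z} (hp : 1 ≤ p)
    (hν : ν ∈ balancedMomentMeasures e p) (c : ℝ) :
    regReal e p α β (ν + c • dirac e) = auxG e p α β (ν, c) := by
  have h : (ν + c • dirac e) Set.univ = c := by
    rw [_root_.add_apply, _root_.smul_apply, dirac_univ, hν.2]; simp
  unfold regReal auxG kruNorm
  rw [krNorm_add_smul_dirac_base hp hν.1, h]
  ring

/-- The linear bijection `(ν, c) ↦ ν + c δ_e` from `ℳ_p⁰(Z) × ℝ` onto `ℳ_p(Z)` maps the auxiliary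
unit ball onto the unit ball, hence extreme points to extreme points. -/
theorem add_smul_dirac_base_mem_extremePoints {q : SignedMeasure Z × ℝ} (hp : 1 ≤ p)
    (hq : q ∈ Set.extremePoints ℝ (auxBall e p α β)) :
    q.1 + q.2 • dirac e ∈ Set.extremePoints ℝ (unitBall e p α β) := by
  have hmem : ∀ {ν : SignedMeasure Z} {c : ℝ}, ν ∈ balancedMomentMeasures e p →
      (ν + c • dirac e ∈ unitBall e p α β ↔ (ν, c) ∈ auxBall e p α β) := by
    intro ν c hν
    rw [mem_unitBall, regReal_add_smul_dirac_base hp hν]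
    exact and_congr_left fun _ => ⟨fun _ => hν, fun _ =>
      add_mem_momentMeasures hν.1 (smul_mem_momentMeasures (dirac_mem_momentMeasures e) c)⟩
  have hbal : ∀ {μ : SignedMeasure Z}, μ ∈ unitBall e p α β →
      (μ - μ Set.univ • dirac e, μ Set.univ) ∈ auxBall e p α β := by
    intro μ hμ
    have h : μ - μ Set.univ • dirac e ∈ balancedMomentMeasures e p := by
      refine ⟨sub_mem_momentMeasures (mem_unitBall.1 hμ).1
        (smul_mem_momentMeasures (dirac_mem_momentMeasures e) _), ?_⟩
      rw [_root_.sub_apply, _root_.smul_apply, dirac_univ]; simp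
    rw [← hmem h, sub_add_cancel]
    exact hμ
  have hqb : q.1 ∈ balancedMomentMeasures e p := hq.1.1
  have hqu : q.1 Set.univ = 0 := hqb.2
  refine ⟨(hmem hqb).2 hq.1, fun μ₁ h₁ μ₂ h₂ h => ?_⟩
  obtain ⟨a, b, ha, hb, hab, h⟩ := h
  have hu : a * μ₁ Set.univ + b * μ₂ Set.univ = q.2 := by
    have := congrArg (fun μ : SignedMeasure Z => μ Set.univ) h
    simpa [dirac_univ, hqu] using this
  have h1 := hq.2 (hbal h₁) (hbal h₂) ⟨a, b, ha, hb, hab, Prod.ext (by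
    change a • (μ₁ - μ₁ Set.univ • dirac e) + b • (μ₂ - μ₂ Set.univ • dirac e) = q.1
    rw [← sub_eq_zero, ← sub_eq_zero.2 h, ← hu]
    module) hu⟩
  rw [← h1]
  simp

end Conclusion

end KRExt

theorem mainTheorem4 {Z : Type*} [MetricSpace Z] [CompleteSpace Z]
    [TopologicalSpace.SeparableSpace Z] [LocallyCompactSpace Z]
    [MeasurableSpace Z] [BorelSpace Z] (hgeo : KRExt.IsGeodesic Z)
    (e : Z) (p α β : ℝ) (hp : 1 ≤ p) (hα : 0 < α) (hβ : 0 < β) :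
    (∀ μ ∈ Set.extremePoints ℝ (KRExt.unitBall e p α β),
      ∃ (x y : Z) (a : ℝ), 0 < a ∧
        μ = a • KRExt.dirac x - a • KRExt.dirac y + μ Set.univ • KRExt.dirac e ∧
        KRExt.regG e p α β μ = 1 ∧
        1 = α * (a * dist x y + |μ Set.univ|) +
          β * ∫ z, (1 + dist z e ^ p)
            ∂(a • KRExt.dirac x - a • KRExt.dirac y
              + μ Set.univ • KRExt.dirac e).totalVariation) ∧
    (∀ q ∈ Set.extremePoints ℝ (KRExt.auxBall e p α β),
      ∃ (x y : Z) (a c : ℝ), 0 < a ∧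
        q = (a • KRExt.dirac x - a • KRExt.dirac y, c)) := by
  have : SecondCountableTopology Z := UniformSpace.secondCountable_of_separable Z
  have : PolishSpace Z := inferInstance
  have : StandardBorelSpace Z := inferInstance
  refine ⟨fun μ hμ => ?_, fun q hq => ?_⟩
  · obtain ⟨x, y, a, ha, hμa⟩ := KRExt.exists_eq_of_mem_extremePoints hp hα hβ hμ
    have hμm := (KRExt.mem_unitBall.1 hμ.1).1
    have h1 := KRExt.regReal_eq_one_of_mem_extremePoints hp hα hβ hμ
    refine ⟨x, y, a, ha, hμa, ?_, ?_⟩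
    · rw [KRExt.regG_eq_coe hμm, h1, EReal.coe_one]
    · have hν : a • KRExt.dirac x - a • KRExt.dirac y ∈ KRExt.momentMeasures e p :=
        KRExt.sub_mem_momentMeasures
          (KRExt.smul_mem_momentMeasures (KRExt.dirac_mem_momentMeasures x) a)
          (KRExt.smul_mem_momentMeasures (KRExt.dirac_mem_momentMeasures y) a)
      have hk : KRExt.krNorm e μ = a * dist x y := by
        rw [hμa, KRExt.krNorm_add_smul_dirac_base hp hν,
          KRExt.krNorm_smul_dirac_sub_smul_dirac x y ha.le]
      rw [← hμa]
      refine h1.symm.trans ?_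
      rw [KRExt.regReal, KRExt.kruNorm, hk, add_comm |μ Set.univ|]
  · have hq' := KRExt.add_smul_dirac_base_mem_extremePoints hp hq
    obtain ⟨x, y, a, ha, hμa⟩ := KRExt.exists_eq_of_mem_extremePoints hp hα hβ hq'
    have hu : (q.1 + q.2 • KRExt.dirac e) Set.univ = q.2 := by
      have h0 : q.1 Set.univ = 0 := hq.1.1.2
      simp [KRExt.dirac_univ, h0]
    rw [hu] at hμa
    exact ⟨x, y, a, q.2, ha, Prod.ext (add_right_cancel hμa) rfl⟩
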